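/- Let $\Upsilon\subseteq\mathbb{R}^m$ and $\Theta\subseteq\mathbb{R}^q$ be open, let $\mathcal{Y}\subseteq\mathbb{R}^n$ be measurable, and let $G:\Upsilon\times\Theta\to\mathcal{Y}$ be three times continuously differentiable such that the $n\times m$ Jacobian matrix $\nabla_u G(u,\theta)$ has full row rank $n$ for all $(u,\theta)\in\Upsilon\times\Theta$. Let $U$ be a random vector in $\Upsilon$ with density $\rho$ with respect to Lebesgue measure. For $\theta\in\Theta$ and $y\in\mathcal{Y}$ let $\mathcal{G}_\theta(y)=\{u\in\Upsilon: G(u,\theta)=y\}$, an $(m-n)$-dimensional embedded submanifold of $\mathbb{R}^m$ (possibly empty), and let $\lambda_{\mathcal{G}_\theta(y)}$ be its Riemannian measure, induced by the Euclidean metric of $\mathbb{R}^m$ (counting measure if $m=n$). Then, for every $\theta\in\Theta$, the data $Y=G(U,\theta)$ have a density $f(\cdot|\theta)$ (the likelihood) with respect to Lebesgue measure on $\mathcal{Y}$, and for Lebesgue-almost every $y\in\mathcal{Y}$ the following integral is finite and $$f(y|\theta)=\int_{\mathcal{G}_\theta(y)}\frac{\rho(u)}{\det\left(\nabla_uG(u,\theta)\,\nabla_uG(u,\theta)^\top\right)^{1/2}}\,\lambda_{\mathcal{G}_\theta(y)}(du).$$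 -/

import Mathlib

open MeasureTheory
open scoped Matrix ENNReal

noncomputable section

/-- The Jacobian matrix `∇F(x)`, of size `b × a`, of a map `F : ℝᵃ → ℝᵇ`. -/
def jacobianMatrix {a b : ℕ} (F : EuclideanSpace ℝ (Fin a) → EuclideanSpace ℝ (Fin b))
    (x : EuclideanSpace ℝ (Fin a)) : Matrix (Fin b) (Fin a) ℝ :=
  Matrix.of fun i j => fderiv ℝ F x (EuclideanSpace.single j 1) i

/-- A `C¹` local parametrization (inverse of a chart) of a `k`-dimensional embedded submanifold
`M` of `ℝᵈ`: an immersion of an open subset of `ℝᵏ` that is a homeomorphism onto a relatively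
open subset of `M`. -/
structure LocalParametrization {d : ℕ} (k : ℕ) (M : Set (EuclideanSpace ℝ (Fin d))) where
  source : Set (EuclideanSpace ℝ (Fin k))
  toFun : EuclideanSpace ℝ (Fin k) → EuclideanSpace ℝ (Fin d)
  isOpen_source : IsOpen source
  contDiffOn : ContDiffOn ℝ 1 toFun source
  injective_fderiv : ∀ x ∈ source, Function.Injective (fderiv ℝ toFun x)
  isEmbedding : Topology.IsEmbedding (source.domRestrict toFun)
  image_eq : ∃ V : Set (EuclideanSpace ℝ (Fin d)), IsOpen V ∧ toFun '' source = M ∩ V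

/-- The Riemannian volume carried by the image of a parametrization `φ`: the push-forward under
`φ` of `√det(gᵢⱼ) dx`, where `gᵢⱼ = ⟨∂ᵢφ, ∂ⱼφ⟩`, i.e. `g = ∇φᵀ ∇φ`, is the metric induced by the
Euclidean metric of the ambient space, in the coordinates given by `φ`. -/
def LocalParametrization.volumeMeasure {d k : ℕ} {M : Set (EuclideanSpace ℝ (Fin d))}
    (φ : LocalParametrization k M) : Measure (EuclideanSpace ℝ (Fin d)) :=
  Measure.map φ.toFun ((volume.restrict φ.source).withDensity fun x =>
    ENNReal.ofReal
      (Real.sqrt ((jacobianMatrix φ.toFun x)ᵀ * jacobianMatrix φ.toFun x).det))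

/-- The Riemannian (intrinsic) measure `λ_M` of a `k`-dimensional embedded submanifold `M` of
`ℝᵈ`, viewed as a measure on `ℝᵈ` carried by `M`. The volumes given by two parametrizations agree
on the overlap of their images, and `M` is covered by countably many such images, so the least
measure that dominates the volume of every parametrization is the measure that coincides with
this volume on the image of every parametrization. (For `k = 0` it is the counting measure.) -/
def riemannianMeasure {d : ℕ} (k : ℕ) (M : Set (EuclideanSpace ℝ (Fin d))) :
    Measure (EuclideanSpace ℝ (Fin d)) :=
  ⨆ φ : LocalParametrization k M, φ.volumeMeasure

/-- The `θ`-section `{u ∈ Υ : G(u, θ) = y}`. -/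
def thetaSection {m n q : ℕ} (Υ : Set (EuclideanSpace ℝ (Fin m)))
    (G : EuclideanSpace ℝ (Fin m) → EuclideanSpace ℝ (Fin q) → EuclideanSpace ℝ (Fin n))
    (θ : EuclideanSpace ℝ (Fin q)) (y : EuclideanSpace ℝ (Fin n)) :
    Set (EuclideanSpace ℝ (Fin m)) :=
  {u | u ∈ Υ ∧ G u θ = y}

/-- The `n × m` Jacobian matrix `∇_u G(u, θ)`. -/
def jacobianU {m n q : ℕ}
    (G : EuclideanSpace ℝ (Fin m) → EuclideanSpace ℝ (Fin q) → EuclideanSpace ℝ (Fin n))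
    (u : EuclideanSpace ℝ (Fin m)) (θ : EuclideanSpace ℝ (Fin q)) :
    Matrix (Fin n) (Fin m) ℝ :=
  jacobianMatrix (fun v => G v θ) u

/-- The likelihood `f(y|θ)`: the density of the data `Y = G(U, θ)` with respect to Lebesgue
measure on the data space `𝒴`. -/
def likelihood {m n q : ℕ} {Ω : Type*} [MeasurableSpace Ω] (P : Measure Ω)
    (U : Ω → EuclideanSpace ℝ (Fin m)) (𝒴 : Set (EuclideanSpace ℝ (Fin n)))
    (G : EuclideanSpace ℝ (Fin m) → EuclideanSpace ℝ (Fin q) → EuclideanSpace ℝ (Fin n))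
    (y : EuclideanSpace ℝ (Fin n)) (θ : EuclideanSpace ℝ (Fin q)) : ℝ≥0∞ :=
  pdf (fun ω => G (U ω) θ) P (volume.restrict 𝒴) y

end

/-! The result is the coarea formula for the submersion `F = G(·, θ)`, with `k = m - n`. Near a
point of `Υ`, complete `F` by a linear map `B` so that `u ↦ (F u, B u)` is a local diffeomorphism.
Its inverse `s` carries slices `{y} × ℝᵏ` to pieces of fibres. Change of variables along `s` and
Tonelli write `∫ g` as an iterated integral in `y` and `z` with weight `|det Ds|`. The slice `z ↦ s
(y, z)` parametrizes the fibre with volume density `√det(QᵀQ)`, where `Q = ∂_z s`. The identity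
`|det Ds| √det(∇F ∇Fᵀ) = √det(QᵀQ)` of `abs_det_mul_sqrt_det_mul_transpose` then yields the formula
on one chart, `FibreChart.setLIntegral_eq`.

To globalize, `Υ` is cut into countably many disjoint measurable pieces, each inside a chart. By
`FibreChart.restrict_volumeMeasure_le`, no parametrization of a fibre exceeds a chart's own volume
on the chart domain, so the supremum defining `riemannianMeasure` is the sum of the chart volumes
over the pieces. Applying the global formula to `ρ` times the indicator of `F⁻¹ A` identifies the
density of `Y`. That density is almost everywhere finite, which makes the fibre integrals genuine
real integrals. -/

noncomputable section

/-! ### Matrices and Gram determinants. -/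

/-- The matrix of a continuous linear map `ℝᵃ → ℝᵇ` in the standard bases. -/
def stdMatrix {a b : ℕ} (L : EuclideanSpace ℝ (Fin a) →L[ℝ] EuclideanSpace ℝ (Fin b)) :
    Matrix (Fin b) (Fin a) ℝ :=
  Matrix.of fun i j => L (EuclideanSpace.single j 1) i

theorem jacobianMatrix_eq_stdMatrix {a b : ℕ}
    (F : EuclideanSpace ℝ (Fin a) → EuclideanSpace ℝ (Fin b)) (x : EuclideanSpace ℝ (Fin a)) :
    jacobianMatrix F x = stdMatrix (fderiv ℝ F x) := rfl

theorem stdMatrix_eq_toMatrix {a b : ℕ}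
    (L : EuclideanSpace ℝ (Fin a) →L[ℝ] EuclideanSpace ℝ (Fin b)) :
    stdMatrix L = LinearMap.toMatrix (EuclideanSpace.basisFun (Fin a) ℝ).toBasis
      (EuclideanSpace.basisFun (Fin b) ℝ).toBasis (L : EuclideanSpace ℝ (Fin a) →ₗ[ℝ] _) := by
  ext i j
  simp [stdMatrix, LinearMap.toMatrix_apply]

theorem stdMatrix_comp {a b c : ℕ}
    (L : EuclideanSpace ℝ (Fin b) →L[ℝ] EuclideanSpace ℝ (Fin c))
    (M : EuclideanSpace ℝ (Fin a) →L[ℝ] EuclideanSpace ℝ (Fin b)) :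
    stdMatrix (L ∘L M) = stdMatrix L * stdMatrix M := by
  simp only [stdMatrix_eq_toMatrix]
  rw [← LinearMap.toMatrix_comp]
  rfl

theorem stdMatrix_id {a : ℕ} :
    stdMatrix (ContinuousLinearMap.id ℝ (EuclideanSpace ℝ (Fin a))) = 1 := by
  rw [stdMatrix_eq_toMatrix]
  exact LinearMap.toMatrix_id _

theorem stdMatrix_zero {a b : ℕ} :
    stdMatrix (0 : EuclideanSpace ℝ (Fin a) →L[ℝ] EuclideanSpace ℝ (Fin b)) = 0 := by
  ext i j
  simp [stdMatrix]

theorem det_stdMatrix {a : ℕ}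
    (L : EuclideanSpace ℝ (Fin a) →L[ℝ] EuclideanSpace ℝ (Fin a)) :
    (stdMatrix L).det = L.det := by
  rw [stdMatrix_eq_toMatrix]
  exact LinearMap.det_toMatrix _ _

theorem rank_stdMatrix {a b : ℕ}
    (L : EuclideanSpace ℝ (Fin a) →L[ℝ] EuclideanSpace ℝ (Fin b)) :
    (stdMatrix L).rank = Module.finrank ℝ (LinearMap.range L.toLinearMap) := by
  rw [stdMatrix_eq_toMatrix, Matrix.rank_eq_finrank_range_toLin _
    (EuclideanSpace.basisFun (Fin b) ℝ).toBasis (EuclideanSpace.basisFun (Fin a) ℝ).toBasis,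
    Matrix.toLin_toMatrix]

theorem measurable_det_jacobianMatrix_mul_transpose {a b : ℕ}
    (F : EuclideanSpace ℝ (Fin a) → EuclideanSpace ℝ (Fin b)) :
    Measurable fun x => (jacobianMatrix F x * (jacobianMatrix F x)ᵀ).det := by
  have h1 : Continuous fun L : EuclideanSpace ℝ (Fin a) →L[ℝ] EuclideanSpace ℝ (Fin b) =>
      (stdMatrix L * (stdMatrix L)ᵀ).det := by
    unfold stdMatrix
    refine Continuous.matrix_det (Continuous.matrix_mul ?_ (Continuous.matrix_transpose ?_)) <;>
    · refine continuous_matrix fun i j => ?_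
      simp only [Matrix.of_apply]
      fun_prop
  exact h1.measurable.comp (measurable_fderiv ℝ F)

theorem measurable_det_transpose_mul_jacobianMatrix {a b : ℕ}
    (F : EuclideanSpace ℝ (Fin a) → EuclideanSpace ℝ (Fin b)) :
    Measurable fun x => ((jacobianMatrix F x)ᵀ * jacobianMatrix F x).det := by
  have h1 : Continuous fun L : EuclideanSpace ℝ (Fin a) →L[ℝ] EuclideanSpace ℝ (Fin b) =>
      ((stdMatrix L)ᵀ * stdMatrix L).det := by
    unfold stdMatrix
    refine Continuous.matrix_det (Continuous.matrix_mul (Continuous.matrix_transpose ?_) ?_) <;>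
    · refine continuous_matrix fun i j => ?_
      simp only [Matrix.of_apply]
      fun_prop
  exact h1.measurable.comp (measurable_fderiv ℝ F)

/-- Precomposing with a square map multiplies the volume density by `|det|`. -/
theorem sqrt_det_gram_comp {a b : ℕ}
    (L : EuclideanSpace ℝ (Fin a) →L[ℝ] EuclideanSpace ℝ (Fin b))
    (T : EuclideanSpace ℝ (Fin a) →L[ℝ] EuclideanSpace ℝ (Fin a)) :
    Real.sqrt ((stdMatrix (L ∘L T))ᵀ * stdMatrix (L ∘L T)).det =
      |T.det| * Real.sqrt ((stdMatrix L)ᵀ * stdMatrix L).det := by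
  have : ((stdMatrix (L ∘L T))ᵀ * stdMatrix (L ∘L T)).det =
      T.det ^ 2 * ((stdMatrix L)ᵀ * stdMatrix L).det := by
    rw [stdMatrix_comp, Matrix.transpose_mul, Matrix.mul_assoc, ← Matrix.mul_assoc _ (stdMatrix L),
      Matrix.det_mul, Matrix.det_mul, Matrix.det_transpose, det_stdMatrix]
    ring
  rw [this, Real.sqrt_mul (sq_nonneg _), Real.sqrt_sq_eq_abs]

/-! ### Linear algebra of a splitting of `ℝⁿ⁺ᵏ`. -/

section Splitting

variable {n k : ℕ}

/-- A row vector `v` with `v A Aᵀ = 0` has `‖v A‖² = 0`, so `v A = 0` and `v = v A P = 0`. -/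
theorem det_mul_transpose_ne_zero (A : Matrix (Fin n) (Fin k) ℝ) (P : Matrix (Fin k) (Fin n) ℝ)
    (h : A * P = 1) : (A * Aᵀ).det ≠ 0 := by
  intro h0
  obtain ⟨v, hv, hv0⟩ := Matrix.exists_vecMul_eq_zero_iff.2 h0
  rw [← Matrix.conjTranspose_eq_transpose_of_trivial] at hv0
  have h1 := (Matrix.vecMul_self_mul_conjTranspose_eq_zero A v).1 hv0
  apply hv
  have : v ᵥ* (A * P) = 0 := by rw [← Matrix.vecMul_vecMul, h1, Matrix.zero_vecMul]
  rwa [h, Matrix.vecMul_one] at this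

/-- If `(A, B) : ℝⁿ⁺ᵏ → ℝⁿ × ℝᵏ` has inverse `s`, the Jacobian of `s` is the ratio of the volume
density of `s (0, ·)` to that of `A`. -/
theorem abs_det_mul_sqrt_det_mul_transpose
    (A : EuclideanSpace ℝ (Fin (n + k)) →L[ℝ] EuclideanSpace ℝ (Fin n))
    (B : EuclideanSpace ℝ (Fin (n + k)) →L[ℝ] EuclideanSpace ℝ (Fin k))
    (s : EuclideanSpace ℝ (Fin n) × EuclideanSpace ℝ (Fin k) →L[ℝ]
      EuclideanSpace ℝ (Fin (n + k)))
    (hl : ∀ u, s (A u, B u) = u) (hA : ∀ p, A (s p) = p.1) (hB : ∀ p, B (s p) = p.2) :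
    let e := (EuclideanSpace.finAddEquivProd (𝕜 := ℝ) (n := n) (m := k))
    let Q := s ∘L ContinuousLinearMap.inr ℝ _ _
    0 < (stdMatrix A * (stdMatrix A)ᵀ).det ∧
    |(s ∘L (e : _ →L[ℝ] _)).det| * Real.sqrt (stdMatrix A * (stdMatrix A)ᵀ).det =
      Real.sqrt ((stdMatrix Q)ᵀ * stdMatrix Q).det := by
  intro e Q
  have hAQ : stdMatrix A * stdMatrix Q = 0 := by
    rw [← stdMatrix_comp, ← stdMatrix_zero]
    congr 1
    ext z i
    simp [Q, hA]
  have hBQ : stdMatrix B * stdMatrix Q = 1 := by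
    rw [← stdMatrix_comp, ← stdMatrix_id]
    congr 1
    ext z i
    simp [Q, hB]
  have hAP : stdMatrix A * stdMatrix (s ∘L ContinuousLinearMap.inl ℝ _ _) = 1 := by
    rw [← stdMatrix_comp, ← stdMatrix_id]
    congr 1
    ext z i
    simp [hA]
  have ha := det_mul_transpose_ne_zero _ _ hAP
  set T : EuclideanSpace ℝ (Fin (n + k)) →L[ℝ] EuclideanSpace ℝ (Fin (n + k)) :=
    (e.symm : _ →L[ℝ] _) ∘L (A.prod B) with hT
  have hr : (s ∘L (e : _ →L[ℝ] _)).det * T.det = 1 := by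
    rw [← det_stdMatrix, ← det_stdMatrix, ← Matrix.det_mul, ← stdMatrix_comp, ← Matrix.det_one (n := Fin (n + k)),
      ← stdMatrix_id]
    congr 2
    ext z i
    simp [hT, hl]
  have hTm : stdMatrix T =
      (Matrix.fromRows (stdMatrix A) (stdMatrix B)).submatrix finSumFinEquiv.symm id := by
    ext i j
    obtain ⟨i, rfl⟩ := finSumFinEquiv.surjective i
    have key : ∀ p : EuclideanSpace ℝ (Fin n) × EuclideanSpace ℝ (Fin k),
        e.symm p (finSumFinEquiv i) = Sum.elim p.1 p.2 i := by
      intro p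
      rcases i with i | i <;> simp [e, EuclideanSpace.finAddEquivProd]
    simp only [stdMatrix, hT, Matrix.of_apply, Matrix.submatrix_apply, Equiv.symm_apply_apply]
    have := key (A (EuclideanSpace.single j 1), B (EuclideanSpace.single j 1))
    rcases i with i | i <;> simpa using this
  -- The columns of `Aᵀ` are orthogonal to those of `Q` because `A Q = 0`. Hence `T C` is block
  -- triangular with diagonal blocks `A Aᵀ` and `1`, while `Cᵀ C` is block diagonal with blocks `A
  -- Aᵀ` and `Qᵀ Q`. Eliminating `det C` gives the identity.
  set C := (Matrix.fromCols (stdMatrix A)ᵀ (stdMatrix Q)).submatrix id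
    (finSumFinEquiv (m := n) (n := k)).symm with hC
  have h1 : T.det * C.det = (stdMatrix A * (stdMatrix A)ᵀ).det := by
    rw [← det_stdMatrix, ← Matrix.det_mul, hTm, hC,
      ← Matrix.submatrix_mul _ _ _ id _ Function.bijective_id,
      Matrix.det_submatrix_equiv_self, Matrix.fromRows_mul_fromCols, hAQ, hBQ,
      Matrix.det_fromBlocks_zero₁₂]
    simp
  have h2 : C.det * C.det = (stdMatrix A * (stdMatrix A)ᵀ).det *
      ((stdMatrix Q)ᵀ * stdMatrix Q).det := by
    have hQA : (stdMatrix Q)ᵀ * (stdMatrix A)ᵀ = 0 := by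
      rw [← Matrix.transpose_mul, hAQ, Matrix.transpose_zero]
    nth_rewrite 1 [← Matrix.det_transpose C]
    rw [← Matrix.det_mul, hC, Matrix.transpose_submatrix,
      ← Matrix.submatrix_mul _ _ _ id _ Function.bijective_id,
      Matrix.det_submatrix_equiv_self, Matrix.transpose_fromCols, Matrix.transpose_transpose,
      Matrix.fromRows_mul_fromCols, hAQ, hQA, Matrix.det_fromBlocks_zero₁₂]
  set a := (stdMatrix A * (stdMatrix A)ᵀ).det
  set q := ((stdMatrix Q)ᵀ * stdMatrix Q).det
  set r := (s ∘L (e : _ →L[ℝ] _)).det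
  have ha0 : 0 ≤ a := by
    have := (Matrix.posSemidef_self_mul_conjTranspose (stdMatrix A)).det_nonneg
    rwa [Matrix.conjTranspose_eq_transpose_of_trivial] at this
  refine ⟨lt_of_le_of_ne ha0 (Ne.symm ha), ?_⟩
  have hq : q = r ^ 2 * a := by
    have hc : C.det = r * a := by
      rw [← h1]; linear_combination (-C.det) * hr
    apply mul_left_cancel₀ ha
    rw [← h2, hc]; ring
  rw [hq, Real.sqrt_mul (sq_nonneg _), Real.sqrt_sq_eq_abs]

/-- Allows the change of variables to be made between subsets of the single space `ℝⁿ⁺ᵏ`, where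
determinants make sense, while Tonelli is used on the product. -/
theorem measurePreserving_finAddEquivProd :
    MeasurePreserving (EuclideanSpace.finAddEquivProd (𝕜 := ℝ) (n := n) (m := k)) := by
  have h1 := (LinearIsometryEquiv.piLpCongrLeft 2 ℝ ℝ
    (finSumFinEquiv (m := n) (n := k)).symm).measurePreserving
  have h2 := EuclideanSpace.volume_preserving_symm_measurableEquiv_toLp (Fin n ⊕ Fin k)
  have h3 := volume_measurePreserving_sumPiEquivProdPi (fun _ : Fin n ⊕ Fin k => ℝ)
  have h4 := (PiLp.volume_preserving_toLp (Fin n)).prod (PiLp.volume_preserving_toLp (Fin k))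
  exact ((h4.comp h3).comp h2).comp h1

end Splitting

/-! ### Charts straightening the fibres. -/

/-- Take `B` to be a linear extension of a coordinate isomorphism `ker A ≃ ℝᵏ`. If `A x = 0` and `B
x = 0`, then `x` lies in the kernel, where `B` is injective; equality of dimensions does the rest.
-/
theorem exists_prod_bijective {n k : ℕ}
    (A : EuclideanSpace ℝ (Fin (n + k)) →L[ℝ] EuclideanSpace ℝ (Fin n))
    (hA : Function.Surjective A) :
    ∃ B : EuclideanSpace ℝ (Fin (n + k)) →L[ℝ] EuclideanSpace ℝ (Fin k),
      ∃ L : EuclideanSpace ℝ (Fin (n + k)) ≃L[ℝ]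
        EuclideanSpace ℝ (Fin n) × EuclideanSpace ℝ (Fin k),
      (L : _ →L[ℝ] _) = A.prod B := by
  have hker : Module.finrank ℝ (LinearMap.ker A.toLinearMap) = k := by
    have h := A.toLinearMap.finrank_range_add_finrank_ker
    rw [LinearMap.range_eq_top.2 hA, finrank_top] at h
    simpa using h
  have hk : Module.finrank ℝ (EuclideanSpace ℝ (Fin k)) =
      Module.finrank ℝ (LinearMap.ker A.toLinearMap) := by rw [hker]; simp
  let ι := LinearEquiv.ofFinrankEq _ _ hk
  obtain ⟨B, hB⟩ := LinearMap.exists_leftInverse_of_injective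
    ((LinearMap.ker A.toLinearMap).subtype ∘ₗ ι.toLinearMap)
    (LinearMap.ker_eq_bot.2 (Subtype.val_injective.comp ι.injective))
  have hinj : Function.Injective (A.toLinearMap.prod B) := by
    rw [← LinearMap.ker_eq_bot, LinearMap.ker_eq_bot']
    intro x hx
    have h1 : A.toLinearMap x = 0 := congrArg Prod.fst hx
    have h2 : B x = 0 := congrArg Prod.snd hx
    have h3 : B (ι (ι.symm ⟨x, h1⟩) : EuclideanSpace ℝ (Fin (n + k))) = ι.symm ⟨x, h1⟩ :=
      LinearMap.congr_fun hB _
    rw [LinearEquiv.apply_symm_apply, h2] at h3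
    exact (congrArg Subtype.val (ι.symm.map_eq_zero_iff.1 h3.symm) :)
  let L := LinearEquiv.ofInjectiveOfFinrankEq (A.toLinearMap.prod B) hinj (by simp)
  refine ⟨B.toContinuousLinearMap, L.toContinuousLinearEquiv, ?_⟩
  ext x <;> rfl

/-- A local straightening of the fibres of `F` over `Υ`: a local homeomorphism `u ↦ (F u, B u)` of
`Υ` with `B` linear and `C¹` inverse. -/
structure FibreChart {n k : ℕ} (F : EuclideanSpace ℝ (Fin (n + k)) → EuclideanSpace ℝ (Fin n))
    (Υ : Set (EuclideanSpace ℝ (Fin (n + k)))) where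
  homeo : OpenPartialHomeomorph (EuclideanSpace ℝ (Fin (n + k)))
    (EuclideanSpace ℝ (Fin n) × EuclideanSpace ℝ (Fin k))
  proj : EuclideanSpace ℝ (Fin (n + k)) →L[ℝ] EuclideanSpace ℝ (Fin k)
  source_subset : homeo.source ⊆ Υ
  homeo_apply : ∀ u ∈ homeo.source, homeo u = (F u, proj u)
  contDiffAt_symm : ∀ p ∈ homeo.target, ContDiffAt ℝ 1 homeo.symm p

/-- Inverse function theorem for `u ↦ (F u, B u)`, with `B` complementing the derivative at the base
point. -/
theorem exists_fibreChart {n k : ℕ}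
    {F : EuclideanSpace ℝ (Fin (n + k)) → EuclideanSpace ℝ (Fin n)}
    {Υ : Set (EuclideanSpace ℝ (Fin (n + k)))} (hΥ : IsOpen Υ) (hF : ContDiffOn ℝ 1 F Υ)
    {u : EuclideanSpace ℝ (Fin (n + k))} (hu : u ∈ Υ)
    (hsurj : Function.Surjective (fderiv ℝ F u)) :
    ∃ S : FibreChart F Υ, u ∈ S.homeo.source := by
  obtain ⟨B, L, hL⟩ := exists_prod_bijective _ hsurj
  set T : EuclideanSpace ℝ (Fin (n + k)) →
    EuclideanSpace ℝ (Fin n) × EuclideanSpace ℝ (Fin k) := fun v => (F v, B v) with hT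
  have hTC : ∀ v ∈ Υ, ContDiffAt ℝ 1 T v := fun v hv =>
    (hF.contDiffAt (hΥ.mem_nhds hv)).prodMk B.contDiff.contDiffAt
  have hTd : ∀ v ∈ Υ, HasFDerivAt T ((fderiv ℝ F v).prod B) v := fun v hv =>
    (((hF.contDiffAt (hΥ.mem_nhds hv)).differentiableAt one_ne_zero).hasFDerivAt).prodMk
      B.hasFDerivAt
  have hTu : HasFDerivAt T (L : _ →L[ℝ] _) u := hL ▸ hTd u hu
  have hcont : ContinuousOn (fun v => (fderiv ℝ F v).prod B) Υ := by
    have h1 := hF.continuousOn_fderiv_of_isOpen hΥ le_rfl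
    have h2 : Continuous fun M : EuclideanSpace ℝ (Fin (n + k)) →L[ℝ] EuclideanSpace ℝ (Fin n) =>
        M.prod B :=
      (ContinuousLinearMap.prodₗᵢ (𝕜 := ℝ) (E := EuclideanSpace ℝ (Fin (n + k)))
        (F := EuclideanSpace ℝ (Fin n)) (G := EuclideanSpace ℝ (Fin k)) ℝ).continuous.comp
        (continuous_id.prodMk continuous_const)
    exact h2.comp_continuousOn h1
  -- Invertibility of the derivative is an open condition. Shrinking the chart to this set makes the
  -- inverse `C¹` at every point of the target, not only at the image of `u`.
  have hO := hcont.isOpen_inter_preimage hΥ (ContinuousLinearEquiv.isOpen (𝕜 := ℝ)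
    (E := EuclideanSpace ℝ (Fin (n + k)))
    (F := EuclideanSpace ℝ (Fin n) × EuclideanSpace ℝ (Fin k)))
  set R := ((hTC u hu).toOpenPartialHomeomorph T hTu one_ne_zero).restrOpen _ hO
  refine ⟨⟨R, B, fun v hv => hv.2.1, fun v _ => rfl, ?_⟩, ?_, hu, L, hL⟩
  · intro p hp
    obtain ⟨hv, M, hM⟩ := (R.map_target hp).2
    exact R.contDiffAt_symm hp (f₀' := M) (by rw [hM]; exact hTd _ hv) (hTC _ hv)
  · exact (hTC u hu).mem_toOpenPartialHomeomorph_source hTu one_ne_zero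

namespace FibreChart

variable {n k : ℕ} {F : EuclideanSpace ℝ (Fin (n + k)) → EuclideanSpace ℝ (Fin n)}
  {Υ : Set (EuclideanSpace ℝ (Fin (n + k)))} (S : FibreChart F Υ)

theorem map_symm {p : EuclideanSpace ℝ (Fin n) × EuclideanSpace ℝ (Fin k)}
    (hp : p ∈ S.homeo.target) : F (S.homeo.symm p) = p.1 ∧ S.proj (S.homeo.symm p) = p.2 := by
  have h := S.homeo_apply _ (S.homeo.map_target hp)
  rw [S.homeo.right_inv hp] at h
  exact ⟨(congrArg Prod.fst h).symm, (congrArg Prod.snd h).symm⟩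

theorem symm_mk {u : EuclideanSpace ℝ (Fin (n + k))} (hu : u ∈ S.homeo.source) :
    (F u, S.proj u) ∈ S.homeo.target ∧ S.homeo.symm (F u, S.proj u) = u := by
  rw [← S.homeo_apply u hu]
  exact ⟨S.homeo.map_source hu, S.homeo.left_inv hu⟩

theorem hasFDerivAt_symm {p : EuclideanSpace ℝ (Fin n) × EuclideanSpace ℝ (Fin k)}
    (hp : p ∈ S.homeo.target) :
    HasFDerivAt S.homeo.symm (fderiv ℝ S.homeo.symm p) p :=
  ((S.contDiffAt_symm p hp).differentiableAt one_ne_zero).hasFDerivAt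

theorem hasFDerivAt_fibre {y : EuclideanSpace ℝ (Fin n)} {z : EuclideanSpace ℝ (Fin k)}
    (hp : (y, z) ∈ S.homeo.target) :
    HasFDerivAt (fun z => S.homeo.symm (y, z))
      (fderiv ℝ S.homeo.symm (y, z) ∘L ContinuousLinearMap.inr ℝ _ _) z :=
  (S.hasFDerivAt_symm hp).comp z (hasFDerivAt_prodMk_right y z)

/-- This and the next two lemmas differentiate identities valid on open sets: the chart and its
inverse compose to the identity. Together they supply the hypotheses on `s` in
`abs_det_mul_sqrt_det_mul_transpose`. -/
theorem proj_fderiv_symm {p : EuclideanSpace ℝ (Fin n) × EuclideanSpace ℝ (Fin k)}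
    (hp : p ∈ S.homeo.target) (q : EuclideanSpace ℝ (Fin n) × EuclideanSpace ℝ (Fin k)) :
    S.proj (fderiv ℝ S.homeo.symm p q) = q.2 := by
  have h1 : HasFDerivAt (fun q => S.proj (S.homeo.symm q))
      (S.proj ∘L fderiv ℝ S.homeo.symm p) p := S.proj.hasFDerivAt.comp p (S.hasFDerivAt_symm hp)
  have h2 : HasFDerivAt (fun q => S.proj (S.homeo.symm q))
      (ContinuousLinearMap.snd ℝ (EuclideanSpace ℝ (Fin n)) (EuclideanSpace ℝ (Fin k))) p := by
    refine hasFDerivAt_snd.congr_of_eventuallyEq ?_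
    filter_upwards [S.homeo.open_target.mem_nhds hp] with q hq using (S.map_symm hq).2
  exact congrArg (· q) (h1.unique h2)

theorem fderiv_fderiv_symm (hΥ : IsOpen Υ) (hF : ContDiffOn ℝ 1 F Υ)
    {p : EuclideanSpace ℝ (Fin n) × EuclideanSpace ℝ (Fin k)}
    (hp : p ∈ S.homeo.target) (q : EuclideanSpace ℝ (Fin n) × EuclideanSpace ℝ (Fin k)) :
    fderiv ℝ F (S.homeo.symm p) (fderiv ℝ S.homeo.symm p q) = q.1 := by
  have hu := S.source_subset (S.homeo.map_target hp)
  have hd := ((hF.contDiffAt (hΥ.mem_nhds hu)).differentiableAt one_ne_zero).hasFDerivAt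
  have h1 : HasFDerivAt (fun q => F (S.homeo.symm q))
      (fderiv ℝ F (S.homeo.symm p) ∘L fderiv ℝ S.homeo.symm p) p :=
    hd.comp p (S.hasFDerivAt_symm hp)
  have h2 : HasFDerivAt (fun q => F (S.homeo.symm q))
      (ContinuousLinearMap.fst ℝ (EuclideanSpace ℝ (Fin n)) (EuclideanSpace ℝ (Fin k))) p := by
    refine hasFDerivAt_fst.congr_of_eventuallyEq ?_
    filter_upwards [S.homeo.open_target.mem_nhds hp] with q hq using (S.map_symm hq).1
  exact congrArg (· q) (h1.unique h2)

theorem fderiv_symm_fderiv (hΥ : IsOpen Υ) (hF : ContDiffOn ℝ 1 F Υ)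
    {p : EuclideanSpace ℝ (Fin n) × EuclideanSpace ℝ (Fin k)}
    (hp : p ∈ S.homeo.target) (v : EuclideanSpace ℝ (Fin (n + k))) :
    fderiv ℝ S.homeo.symm p (fderiv ℝ F (S.homeo.symm p) v, S.proj v) = v := by
  have hs := S.homeo.map_target hp
  have hu := S.source_subset hs
  have hd := ((hF.contDiffAt (hΥ.mem_nhds hu)).differentiableAt one_ne_zero).hasFDerivAt
  have hpe : (F (S.homeo.symm p), S.proj (S.homeo.symm p)) = p :=
    Prod.ext (S.map_symm hp).1 (S.map_symm hp).2
  have h0 := S.hasFDerivAt_symm hp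
  have h1 : HasFDerivAt (fun u => S.homeo.symm (F u, S.proj u))
      (fderiv ℝ S.homeo.symm p ∘L (fderiv ℝ F (S.homeo.symm p)).prod S.proj)
      (S.homeo.symm p) := by
    refine HasFDerivAt.comp (S.homeo.symm p) ?_ (hd.prodMk S.proj.hasFDerivAt)
    rwa [hpe]
  have h2 : HasFDerivAt (fun u => S.homeo.symm (F u, S.proj u))
      (ContinuousLinearMap.id ℝ _) (S.homeo.symm p) := by
    refine (hasFDerivAt_id _).congr_of_eventuallyEq ?_
    filter_upwards [S.homeo.open_source.mem_nhds hs] with q hq using (S.symm_mk hq).2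
  exact congrArg (· v) (h1.unique h2)

/-- The parametrization of a fibre of `F` given by a chart straightening the fibres. -/
def fibreParametrization (y : EuclideanSpace ℝ (Fin n)) :
    LocalParametrization k {u | u ∈ Υ ∧ F u = y} where
  source := {z | (y, z) ∈ S.homeo.target}
  toFun z := S.homeo.symm (y, z)
  isOpen_source := S.homeo.open_target.preimage (by fun_prop)
  contDiffOn z hz := ((S.contDiffAt_symm (y, z) hz).comp z
    (contDiffAt_const.prodMk contDiffAt_id)).contDiffWithinAt
  injective_fderiv z hz := by
    rw [(S.hasFDerivAt_fibre hz).fderiv]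
    refine Function.LeftInverse.injective (g := S.proj) fun w => ?_
    simp [S.proj_fderiv_symm hz]
  isEmbedding := by
    -- Composing with `S.proj` gives back `z`, so the continuous map `z ↦ S.homeo.symm (y, z)` is an
    -- embedding.
    refine Topology.IsEmbedding.of_comp (g := S.proj) ?_ S.proj.continuous ?_
    · exact (S.homeo.continuousOn_symm.comp (f := fun z => (y, z))
        (s := {z | (y, z) ∈ S.homeo.target}) (by fun_prop) fun z hz => hz).domRestrict
    · convert! Topology.IsEmbedding.subtypeVal using 1
      ext1 z
      exact (S.map_symm z.2).2
  image_eq := by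
    refine ⟨S.homeo.source, S.homeo.open_source, ?_⟩
    ext u
    constructor
    · rintro ⟨z, hz, rfl⟩
      exact ⟨⟨S.source_subset (S.homeo.map_target hz), (S.map_symm hz).1⟩, S.homeo.map_target hz⟩
    · rintro ⟨⟨_, rfl⟩, hu⟩
      exact ⟨S.proj u, (S.symm_mk hu).1, (S.symm_mk hu).2⟩

end FibreChart

/-! ### Volume of a parametrization. -/

theorem ContinuousOn.measurableSet_inter_preimage {α β : Type*} [TopologicalSpace α]
    [MeasurableSpace α] [OpensMeasurableSpace α] [TopologicalSpace β] [MeasurableSpace β]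
    [BorelSpace β] {f : α → β} {s : Set α} (hf : ContinuousOn f s) (hs : MeasurableSet s)
    {A : Set β} (hA : MeasurableSet A) : MeasurableSet (s ∩ f ⁻¹' A) := by
  rw [← Subtype.image_preimage_val]
  exact hs.subtype_image (hf.domRestrict.measurable hA)

theorem LocalParametrization.lintegral_volumeMeasure {d k : ℕ}
    {M : Set (EuclideanSpace ℝ (Fin d))} (φ : LocalParametrization k M)
    {g : EuclideanSpace ℝ (Fin d) → ℝ≥0∞} (hg : Measurable g) :
    ∫⁻ u, g u ∂φ.volumeMeasure = ∫⁻ x in φ.source, ENNReal.ofReal (Real.sqrt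
      ((jacobianMatrix φ.toFun x)ᵀ * jacobianMatrix φ.toFun x).det) * g (φ.toFun x) := by
  have hφ : AEMeasurable φ.toFun (volume.restrict φ.source) :=
    φ.contDiffOn.continuousOn.aemeasurable φ.isOpen_source.measurableSet
  rw [volumeMeasure, lintegral_map' hg.aemeasurable
    (hφ.mono_ac (withDensity_absolutelyContinuous _ _)),
    lintegral_withDensity_eq_lintegral_mul₀ ?_ (g := fun x => g (φ.toFun x))
      (hg.comp_aemeasurable hφ)]
  · rfl
  · exact (measurable_det_transpose_mul_jacobianMatrix _).sqrt.ennreal_ofReal.aemeasurable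

theorem LocalParametrization.volumeMeasure_apply {d k : ℕ}
    {M : Set (EuclideanSpace ℝ (Fin d))} (φ : LocalParametrization k M)
    {A : Set (EuclideanSpace ℝ (Fin d))} (hA : MeasurableSet A) :
    φ.volumeMeasure A = ∫⁻ x in φ.source ∩ φ.toFun ⁻¹' A, ENNReal.ofReal (Real.sqrt
      ((jacobianMatrix φ.toFun x)ᵀ * jacobianMatrix φ.toFun x).det) := by
  have hD := φ.contDiffOn.continuousOn.measurableSet_inter_preimage
    φ.isOpen_source.measurableSet hA
  rw [← lintegral_indicator_one hA, φ.lintegral_volumeMeasure (measurable_one.indicator hA),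
    ← lintegral_indicator φ.isOpen_source.measurableSet, ← lintegral_indicator hD]
  congr 1
  ext x
  by_cases h1 : x ∈ φ.source <;> by_cases h2 : φ.toFun x ∈ A <;> simp [Set.indicator, h1, h2]

theorem LocalParametrization.volumeMeasure_compl {d k : ℕ}
    {M : Set (EuclideanSpace ℝ (Fin d))} (φ : LocalParametrization k M)
    {A : Set (EuclideanSpace ℝ (Fin d))} (hA : MeasurableSet A) (h : M ⊆ A) :
    φ.volumeMeasure Aᶜ = 0 := by
  obtain ⟨V, -, hV⟩ := φ.image_eq
  rw [φ.volumeMeasure_apply hA.compl]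
  have : φ.source ∩ φ.toFun ⁻¹' Aᶜ = ∅ := by
    ext x
    simp only [Set.mem_inter_iff, Set.mem_preimage, Set.mem_compl_iff, Set.mem_empty_iff_false,
      iff_false, not_and, not_not]
    intro hx
    have : φ.toFun x ∈ M ∩ V := hV ▸ Set.mem_image_of_mem _ hx
    exact h this.1
  rw [this, Measure.restrict_empty, lintegral_zero_measure]

/-! ### Comparison of volumes and coarea formula on one chart. -/

namespace FibreChart

variable {n k : ℕ} {F : EuclideanSpace ℝ (Fin (n + k)) → EuclideanSpace ℝ (Fin n)}
  {Υ : Set (EuclideanSpace ℝ (Fin (n + k)))} (S : FibreChart F Υ)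

/-- The volume of any parametrization of a fibre is dominated, on the domain of a chart, by the
volume of the parametrization given by this chart. -/
theorem restrict_volumeMeasure_le (y : EuclideanSpace ℝ (Fin n))
    (φ : LocalParametrization k {u | u ∈ Υ ∧ F u = y}) :
    φ.volumeMeasure.restrict S.homeo.source ≤ (S.fibreParametrization y).volumeMeasure := by
  refine Measure.le_iff.2 fun A hA => ?_
  have hV := S.homeo.open_source
  rw [Measure.restrict_apply hA, φ.volumeMeasure_apply (hA.inter hV.measurableSet),
    (S.fibreParametrization y).volumeMeasure_apply hA]
  set D := φ.source ∩ φ.toFun ⁻¹' (A ∩ S.homeo.source) with hDdef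
  have hD : MeasurableSet D := φ.contDiffOn.continuousOn.measurableSet_inter_preimage
    φ.isOpen_source.measurableSet (hA.inter hV.measurableSet)
  set ψ := S.fibreParametrization y with hψ
  have hO : IsOpen (φ.source ∩ φ.toFun ⁻¹' S.homeo.source) :=
    φ.contDiffOn.continuousOn.isOpen_inter_preimage φ.isOpen_source hV
  have hM : ∀ x ∈ φ.source, F (φ.toFun x) = y := by
    intro x hx
    obtain ⟨V, -, h⟩ := φ.image_eq
    have : φ.toFun x ∈ {u | u ∈ Υ ∧ F u = y} ∩ V := h ▸ Set.mem_image_of_mem _ hx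
    exact this.1.2
  -- On the chart domain `φ = ψ ∘ τ` with transition map `τ = S.proj ∘ φ`. The chain rule multiplies
  -- the volume density by `|det Dτ|`, which the change of variables along the injective `τ`
  -- absorbs.
  have hfac : ∀ x ∈ φ.source ∩ φ.toFun ⁻¹' S.homeo.source,
      S.proj (φ.toFun x) ∈ ψ.source ∧ ψ.toFun (S.proj (φ.toFun x)) = φ.toFun x := by
    intro x hx
    have h := S.symm_mk hx.2
    rw [hM x hx.1] at h
    exact h
  have hDO : D ⊆ φ.source ∩ φ.toFun ⁻¹' S.homeo.source := fun x hx => ⟨hx.1, hx.2.2⟩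
  have hφd : ∀ x ∈ φ.source, HasFDerivAt φ.toFun (fderiv ℝ φ.toFun x) x := fun x hx =>
    ((φ.contDiffOn.contDiffAt (φ.isOpen_source.mem_nhds hx)).differentiableAt
      one_ne_zero).hasFDerivAt
  have hτd : ∀ x ∈ φ.source,
      HasFDerivAt (fun x => S.proj (φ.toFun x)) (S.proj ∘L fderiv ℝ φ.toFun x) x := fun x hx =>
    S.proj.hasFDerivAt.comp x (hφd x hx)
  have hinj : Set.InjOn (fun x => S.proj (φ.toFun x)) D := by
    intro x hx x' hx' h
    have h1 : φ.toFun x = φ.toFun x' := by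
      rw [← (hfac x (hDO hx)).2, ← (hfac x' (hDO hx')).2]
      exact congrArg ψ.toFun h
    exact congrArg Subtype.val
      (φ.isEmbedding.injective (a₁ := ⟨x, hx.1⟩) (a₂ := ⟨x', hx'.1⟩) h1)
  have hcv := lintegral_image_eq_lintegral_abs_det_fderiv_mul volume hD
    (fun x hx => (hτd x hx.1).hasFDerivWithinAt) hinj
    (fun z => ENNReal.ofReal (Real.sqrt ((jacobianMatrix ψ.toFun z)ᵀ *
      jacobianMatrix ψ.toFun z).det))
  have hint : ∫⁻ x in D, ENNReal.ofReal (Real.sqrt ((jacobianMatrix φ.toFun x)ᵀ *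
        jacobianMatrix φ.toFun x).det) =
      ∫⁻ x in D, ENNReal.ofReal |(S.proj ∘L fderiv ℝ φ.toFun x).det| *
        ENNReal.ofReal (Real.sqrt ((jacobianMatrix ψ.toFun (S.proj (φ.toFun x)))ᵀ *
          jacobianMatrix ψ.toFun (S.proj (φ.toFun x))).det) := by
    refine setLIntegral_congr_fun hD fun x hx => ?_
    have hψd : HasFDerivAt ψ.toFun (fderiv ℝ ψ.toFun (S.proj (φ.toFun x)))
        (S.proj (φ.toFun x)) :=
      ((ψ.contDiffOn.contDiffAt (ψ.isOpen_source.mem_nhds (hfac x (hDO hx)).1)).differentiableAt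
        one_ne_zero).hasFDerivAt
    have h1 : HasFDerivAt φ.toFun (fderiv ℝ ψ.toFun (S.proj (φ.toFun x)) ∘L
        (S.proj ∘L fderiv ℝ φ.toFun x)) x := by
      refine (hψd.comp x (hτd x hx.1)).congr_of_eventuallyEq ?_
      filter_upwards [hO.mem_nhds (hDO hx)] with x' hx' using (hfac x' hx').2.symm
    simp only [jacobianMatrix_eq_stdMatrix]
    rw [h1.fderiv, sqrt_det_gram_comp, ENNReal.ofReal_mul (abs_nonneg _), ← h1.fderiv]
  rw [hint, ← hcv]
  -- Only an inequality results, since `τ` maps `D` into the domain of `ψ`, perhaps not onto the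
  -- part lying over `A`.
  refine lintegral_mono_set ?_
  rintro _ ⟨x, hx, rfl⟩
  refine ⟨(hfac x (hDO hx)).1, ?_⟩
  rw [Set.mem_preimage, (hfac x (hDO hx)).2]
  exact hx.2.1

/-- Coarea formula on the domain of a chart. -/
theorem setLIntegral_eq (hΥ : IsOpen Υ) (hF : ContDiffOn ℝ 1 F Υ)
    {W : Set (EuclideanSpace ℝ (Fin (n + k)))} (hW : MeasurableSet W) (hWS : W ⊆ S.homeo.source)
    {g : EuclideanSpace ℝ (Fin (n + k)) → ℝ≥0∞} (hg : Measurable g) :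
    (Measurable fun y => ∫⁻ u in W, g u / ENNReal.ofReal
        (Real.sqrt (jacobianMatrix F u * (jacobianMatrix F u)ᵀ).det)
        ∂(S.fibreParametrization y).volumeMeasure) ∧
    ∫⁻ u in W, g u = ∫⁻ y, ∫⁻ u in W, g u / ENNReal.ofReal
        (Real.sqrt (jacobianMatrix F u * (jacobianMatrix F u)ᵀ).det)
        ∂(S.fibreParametrization y).volumeMeasure := by
  classical
  set e := (EuclideanSpace.finAddEquivProd (𝕜 := ℝ) (n := n) (m := k))
  have hT := S.homeo.open_target.measurableSet
  -- The integrand in straightened coordinates, extended by zero: integrating it in `z` gives the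
  -- fibre integral, and integrating it in `(y, z)` gives `∫ g` over `W`.
  set H : EuclideanSpace ℝ (Fin n) × EuclideanSpace ℝ (Fin k) → ℝ≥0∞ :=
    S.homeo.target.indicator fun p =>
      ENNReal.ofReal |(fderiv ℝ S.homeo.symm p ∘L (e : _ →L[ℝ] _)).det| *
        W.indicator g (S.homeo.symm p) with hH
  have hHm : Measurable H := by
    -- The inverse chart is controlled only on its target, so it is replaced by zero elsewhere to
    -- obtain a measurable map.
    have h1 : Measurable (S.homeo.target.piecewise S.homeo.symm fun _ => 0) := by
      refine measurable_of_restrict_of_restrict_compl hT ?_ ?_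
      · rw [Set.domRestrict_piecewise]
        exact S.homeo.continuousOn_symm.domRestrict.measurable
      · rw [Set.domRestrict_piecewise_compl]
        exact measurable_const
    have h2 : H = S.homeo.target.indicator fun p =>
        ENNReal.ofReal |(fderiv ℝ S.homeo.symm p ∘L (e : _ →L[ℝ] _)).det| *
          W.indicator g (S.homeo.target.piecewise S.homeo.symm (fun _ => 0) p) := by
      ext p
      by_cases hp : p ∈ S.homeo.target <;> simp [hH, hp]
    rw [h2]
    refine Measurable.indicator (Measurable.mul ?_ ((hg.indicator hW).comp h1)) hT
    have h3 : Continuous fun L : (EuclideanSpace ℝ (Fin n) × EuclideanSpace ℝ (Fin k)) →L[ℝ]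
        EuclideanSpace ℝ (Fin (n + k)) => ENNReal.ofReal |(L ∘L (e : _ →L[ℝ] _)).det| := by
      refine ENNReal.continuous_ofReal.comp (continuous_abs.comp
        (ContinuousLinearMap.continuous_det.comp ?_))
      fun_prop
    exact h3.measurable.comp (measurable_fderiv ℝ _)
  have hfib : ∀ y, ∫⁻ u in W, g u / ENNReal.ofReal
      (Real.sqrt (jacobianMatrix F u * (jacobianMatrix F u)ᵀ).det)
      ∂(S.fibreParametrization y).volumeMeasure = ∫⁻ z, H (y, z) := by
    intro y
    have hm : Measurable fun u => g u / ENNReal.ofReal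
        (Real.sqrt (jacobianMatrix F u * (jacobianMatrix F u)ᵀ).det) :=
      hg.div (measurable_det_jacobianMatrix_mul_transpose F).sqrt.ennreal_ofReal
    rw [← lintegral_indicator hW, LocalParametrization.lintegral_volumeMeasure _ (hm.indicator hW),
      ← lintegral_indicator (S.fibreParametrization y).isOpen_source.measurableSet]
    congr 1
    ext z
    by_cases hz : (y, z) ∈ S.homeo.target
    swap
    · rw [Set.indicator_of_notMem, hH, Set.indicator_of_notMem hz]
      exact hz
    rw [Set.indicator_of_mem (show z ∈ (S.fibreParametrization y).source from hz), hH,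
      Set.indicator_of_mem hz]
    have hval : (S.fibreParametrization y).toFun z = S.homeo.symm (y, z) := rfl
    have hder : fderiv ℝ (S.fibreParametrization y).toFun z =
      fderiv ℝ S.homeo.symm (y, z) ∘L ContinuousLinearMap.inr ℝ _ _ :=
        (S.hasFDerivAt_fibre hz).fderiv
    rw [hval]
    by_cases hw : S.homeo.symm (y, z) ∈ W
    swap
    · simp [hw]
    rw [Set.indicator_of_mem hw, Set.indicator_of_mem hw]
    obtain ⟨hpos, hdet⟩ := abs_det_mul_sqrt_det_mul_transpose
      (fderiv ℝ F (S.homeo.symm (y, z))) S.proj (fderiv ℝ S.homeo.symm (y, z))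
      (S.fderiv_symm_fderiv hΥ hF hz) (S.fderiv_fderiv_symm hΥ hF hz) (S.proj_fderiv_symm hz)
    simp only [jacobianMatrix_eq_stdMatrix]
    rw [hder, ← hdet, ENNReal.ofReal_mul (abs_nonneg _), mul_assoc, ENNReal.mul_div_cancel]
    · simpa using hpos
    · exact ENNReal.ofReal_ne_top
  simp only [hfib]
  refine ⟨hHm.lintegral_prod_right', ?_⟩
  rw [← lintegral_prod _ hHm.aemeasurable, ← Measure.volume_eq_prod,
    ← measurePreserving_finAddEquivProd.lintegral_comp hHm]
  have hET : MeasurableSet (e ⁻¹' S.homeo.target) := e.continuous.measurable hT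
  have hd : ∀ x ∈ e ⁻¹' S.homeo.target, HasFDerivWithinAt (fun x => S.homeo.symm (e x))
      (fderiv ℝ S.homeo.symm (e x) ∘L (e : EuclideanSpace ℝ (Fin (n + k)) →L[ℝ] _))
      (e ⁻¹' S.homeo.target) x := fun x hx =>
    (HasFDerivAt.comp x (S.hasFDerivAt_symm hx) e.hasFDerivAt).hasFDerivWithinAt
  have hcv := lintegral_image_eq_lintegral_abs_det_fderiv_mul volume hET hd
    (fun x hx x' hx' h => e.injective (S.homeo.symm.injOn hx hx' h)) (W.indicator g)
  have himg : (fun x => S.homeo.symm (e x)) '' (e ⁻¹' S.homeo.target) = S.homeo.source := by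
    rw [← S.homeo.symm_image_target_eq_source]
    ext u
    constructor
    · rintro ⟨x, hx, rfl⟩
      exact ⟨e x, hx, rfl⟩
    · rintro ⟨p, hp, rfl⟩
      exact ⟨e.symm p, by simpa using hp, by simp⟩
  rw [himg, ← lintegral_indicator hET] at hcv
  rw [setLIntegral_indicator hW, Set.inter_eq_left.2 hWS] at hcv
  rw [hcv]
  rfl

end FibreChart

/-! ### Gluing, and the image of a density under a submersion. -/

section Submersion

variable {n k : ℕ} {F : EuclideanSpace ℝ (Fin (n + k)) → EuclideanSpace ℝ (Fin n)}
  {Υ : Set (EuclideanSpace ℝ (Fin (n + k)))}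

/-- Lindelöf extracts countably many charts, made disjoint by subtracting the earlier domains.
Nonemptiness of `Υ` provides at least one chart, so the family can be indexed by `ℕ`. -/
theorem exists_fibreChart_cover (hΥ : IsOpen Υ) (hne : Υ.Nonempty) (hF : ContDiffOn ℝ 1 F Υ)
    (hsurj : ∀ u ∈ Υ, Function.Surjective (fderiv ℝ F u)) :
    ∃ (S : ℕ → FibreChart F Υ) (W : ℕ → Set (EuclideanSpace ℝ (Fin (n + k)))),
      (∀ i, MeasurableSet (W i)) ∧ (∀ i, W i ⊆ (S i).homeo.source) ∧
      Pairwise (Function.onFun Disjoint W) ∧ ⋃ i, W i = Υ := by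
  obtain ⟨T, hTc, hT⟩ := TopologicalSpace.isOpen_iUnion_countable
    (fun S : FibreChart F Υ => S.homeo.source) fun S => S.homeo.open_source
  have hU : ⋃ S : FibreChart F Υ, S.homeo.source = Υ := by
    refine (Set.iUnion_subset fun S => S.source_subset).antisymm fun u hu => ?_
    obtain ⟨S, hS⟩ := exists_fibreChart hΥ hF hu (hsurj u hu)
    exact Set.mem_iUnion.2 ⟨S, hS⟩
  have hTne : T.Nonempty := by
    obtain ⟨u, hu⟩ := hne
    rw [← hU, ← hT] at hu
    obtain ⟨S, hS, -⟩ := Set.mem_iUnion₂.1 hu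
    exact ⟨S, hS⟩
  obtain ⟨S, rfl⟩ := hTc.exists_eq_range hTne
  refine ⟨S, disjointed fun i => (S i).homeo.source,
    MeasurableSet.disjointed fun i => (S i).homeo.open_source.measurableSet,
    disjointed_subset _, disjoint_disjointed _, ?_⟩
  rw [Set.biUnion_range] at hT
  rw [iUnion_disjointed, hT, hU]

/-- The Riemannian measure of a fibre is glued from the volumes given by charts. -/
theorem riemannianMeasure_fibre_eq_sum {S : ℕ → FibreChart F Υ}
    {W : ℕ → Set (EuclideanSpace ℝ (Fin (n + k)))} (hW : ∀ i, MeasurableSet (W i))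
    (hWS : ∀ i, W i ⊆ (S i).homeo.source) (hd : Pairwise (Function.onFun Disjoint W))
    (hU : ⋃ i, W i = Υ) (y : EuclideanSpace ℝ (Fin n)) :
    riemannianMeasure k {u | u ∈ Υ ∧ F u = y} =
      Measure.sum fun i => ((S i).fibreParametrization y).volumeMeasure.restrict (W i) := by
  apply le_antisymm
  · refine iSup_le fun φ => ?_
    have h1 : φ.volumeMeasure = φ.volumeMeasure.restrict (⋃ i, W i) := by
      refine (Measure.restrict_eq_self_of_ae_mem ?_).symm
      refine φ.volumeMeasure_compl (MeasurableSet.iUnion hW) ?_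
      rw [hU]
      exact fun u hu => hu.1
    rw [h1, Measure.restrict_iUnion hd hW]
    refine Measure.le_iff.2 fun A hA => ?_
    rw [Measure.sum_apply _ hA, Measure.sum_apply _ hA]
    refine ENNReal.tsum_le_tsum fun i => ?_
    have h2 := Measure.restrict_mono (subset_refl (W i)) ((S i).restrict_volumeMeasure_le y φ)
    rw [Measure.restrict_restrict (hW i), Set.inter_eq_left.2 (hWS i)] at h2
    exact h2 A
  -- Each chart volume is one of the terms of the supremum; the disjoint pieces then recombine.
  · calc _ ≤ Measure.sum fun i =>
          (riemannianMeasure k {u | u ∈ Υ ∧ F u = y}).restrict (W i) := by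
          refine Measure.le_iff.2 fun A hA => ?_
          rw [Measure.sum_apply _ hA, Measure.sum_apply _ hA]
          refine ENNReal.tsum_le_tsum fun i => ?_
          exact Measure.restrict_mono (subset_refl _) (le_iSup (fun φ :
            LocalParametrization k {u | u ∈ Υ ∧ F u = y} => φ.volumeMeasure)
            ((S i).fibreParametrization y)) A
      _ = (riemannianMeasure k {u | u ∈ Υ ∧ F u = y}).restrict (⋃ i, W i) :=
          (Measure.restrict_iUnion hd hW).symm
      _ ≤ _ := Measure.restrict_le_self

theorem riemannianMeasure_fibre_compl (hΥ : IsOpen Υ) (hne : Υ.Nonempty)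
    (hF : ContDiffOn ℝ 1 F Υ) (hsurj : ∀ u ∈ Υ, Function.Surjective (fderiv ℝ F u))
    (y : EuclideanSpace ℝ (Fin n)) :
    riemannianMeasure k {u | u ∈ Υ ∧ F u = y} {u | u ∈ Υ ∧ F u = y}ᶜ = 0 := by
  obtain ⟨S, W, hW, hWS, hd, hU⟩ := exists_fibreChart_cover hΥ hne hF hsurj
  have hM : MeasurableSet {u | u ∈ Υ ∧ F u = y} :=
    hF.continuousOn.measurableSet_inter_preimage hΥ.measurableSet (measurableSet_singleton y)
  rw [riemannianMeasure_fibre_eq_sum hW hWS hd hU, Measure.sum_apply _ hM.compl,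
    ENNReal.tsum_eq_zero]
  exact fun i => le_antisymm ((Measure.restrict_le_self _).trans_eq
    (LocalParametrization.volumeMeasure_compl _ hM subset_rfl)) zero_le

/-- Coarea formula for a submersion. -/
theorem setLIntegral_eq_lintegral_fibre (hΥ : IsOpen Υ) (hne : Υ.Nonempty)
    (hF : ContDiffOn ℝ 1 F Υ) (hsurj : ∀ u ∈ Υ, Function.Surjective (fderiv ℝ F u))
    {g : EuclideanSpace ℝ (Fin (n + k)) → ℝ≥0∞} (hg : Measurable g) :
    (Measurable fun y => ∫⁻ u, g u / ENNReal.ofReal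
        (Real.sqrt (jacobianMatrix F u * (jacobianMatrix F u)ᵀ).det)
        ∂(riemannianMeasure k {u | u ∈ Υ ∧ F u = y})) ∧
    ∫⁻ u in Υ, g u = ∫⁻ y, ∫⁻ u, g u / ENNReal.ofReal
        (Real.sqrt (jacobianMatrix F u * (jacobianMatrix F u)ᵀ).det)
        ∂(riemannianMeasure k {u | u ∈ Υ ∧ F u = y}) := by
  obtain ⟨S, W, hW, hWS, hd, hU⟩ := exists_fibreChart_cover hΥ hne hF hsurj
  simp only [riemannianMeasure_fibre_eq_sum hW hWS hd hU, lintegral_sum_measure]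
  have h := fun i => (S i).setLIntegral_eq hΥ hF (hW i) (hWS i) hg
  refine ⟨Measurable.tsum fun i => (h i).1, ?_⟩
  rw [lintegral_tsum fun i => (h i).1.aemeasurable]
  refine (congrArg (fun s => ∫⁻ u in s, g u) hU.symm).trans ?_
  rw [lintegral_iUnion hW hd]
  exact tsum_congr fun i => (h i).2

theorem det_jacobianMatrix_mul_transpose_pos {u : EuclideanSpace ℝ (Fin (n + k))}
    (hsurj : Function.Surjective (fderiv ℝ F u)) :
    0 < (jacobianMatrix F u * (jacobianMatrix F u)ᵀ).det := by
  obtain ⟨B, L, hL⟩ := exists_prod_bijective _ hsurj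
  have hLu : ∀ v, L v = (fderiv ℝ F u v, B v) := fun v => congrArg (· v) hL
  refine (abs_det_mul_sqrt_det_mul_transpose (fderiv ℝ F u) B
    (L.symm : _ →L[ℝ] _) ?_ ?_ ?_).1
  · intro v
    rw [← hLu]
    exact L.symm_apply_apply v
  · intro p
    exact (congrArg Prod.fst (hLu (L.symm p))).symm.trans
      (congrArg Prod.fst (L.apply_symm_apply p))
  · intro p
    exact (congrArg Prod.snd (hLu (L.symm p))).symm.trans
      (congrArg Prod.snd (L.apply_symm_apply p))

/-- The image of a measure with density `g` on `Υ` under a submersion has as density the integral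
of `g / √det(∇F ∇Fᵀ)` over the fibres. -/
theorem map_withDensity_eq_withDensity_fibre (hΥ : IsOpen Υ) (hne : Υ.Nonempty)
    (hF : ContDiffOn ℝ 1 F Υ) (hsurj : ∀ u ∈ Υ, Function.Surjective (fderiv ℝ F u))
    {g : EuclideanSpace ℝ (Fin (n + k)) → ℝ≥0∞} (hg : Measurable g)
    {𝒴 : Set (EuclideanSpace ℝ (Fin n))} (h𝒴 : MeasurableSet 𝒴)
    (hF𝒴 : ∀ u ∈ Υ, F u ∈ 𝒴) :
    Measure.map F ((volume.restrict Υ).withDensity g) =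
      (volume.restrict 𝒴).withDensity fun y => ∫⁻ u, g u / ENNReal.ofReal
        (Real.sqrt (jacobianMatrix F u * (jacobianMatrix F u)ᵀ).det)
        ∂(riemannianMeasure k {u | u ∈ Υ ∧ F u = y}) := by
  have hFm : AEMeasurable F ((volume.restrict Υ).withDensity g) :=
    (hF.continuousOn.aemeasurable hΥ.measurableSet).mono_ac (withDensity_absolutelyContinuous _ _)
  ext A hA
  have hD : MeasurableSet (Υ ∩ F ⁻¹' A) :=
    hF.continuousOn.measurableSet_inter_preimage hΥ.measurableSet hA
  rw [Measure.map_apply_of_aemeasurable hFm hA, ← restrict_withDensity hΥ.measurableSet,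
    Measure.restrict_apply' hΥ.measurableSet, Set.inter_comm, withDensity_apply _ hD,
    withDensity_apply _ hA, Measure.restrict_restrict hA]
  -- With the indicator of `F⁻¹ A` inside the integrand, a fibre contributes either entirely (`y ∈
  -- A`) or not at all.
  have h1 : ∫⁻ u in Υ ∩ F ⁻¹' A, g u = ∫⁻ u in Υ, (Υ ∩ F ⁻¹' A).indicator g u := by
    rw [setLIntegral_indicator hD, Set.inter_eq_left.2 Set.inter_subset_left]
  rw [h1, (setLIntegral_eq_lintegral_fibre hΥ hne hF hsurj (hg.indicator hD)).2,
    ← lintegral_indicator (hA.inter h𝒴)]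
  congr 1
  ext y
  have hae : ∀ᵐ u ∂(riemannianMeasure k {u | u ∈ Υ ∧ F u = y}), u ∈ Υ ∧ F u = y :=
    riemannianMeasure_fibre_compl hΥ hne hF hsurj y
  by_cases hy : y ∈ A ∩ 𝒴
  · rw [Set.indicator_of_mem hy]
    refine lintegral_congr_ae ?_
    filter_upwards [hae] with u hu
    rw [Set.indicator_of_mem]
    exact ⟨hu.1, by rw [Set.mem_preimage, hu.2]; exact hy.1⟩
  · rw [Set.indicator_of_notMem hy]
    refine (lintegral_congr_ae ?_).trans lintegral_zero
    filter_upwards [hae] with u hu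
    rw [Set.indicator_of_notMem, ENNReal.zero_div]
    rintro ⟨-, huA⟩
    rw [Set.mem_preimage, hu.2] at huA
    -- For `y` outside `𝒴` the fibre is empty.
    exact hy ⟨huA, hu.2 ▸ hF𝒴 u hu.1⟩

end Submersion

end

/-! ### The likelihood. -/

theorem surjective_fderiv_of_rank_jacobianMatrix {a b : ℕ}
    {F : EuclideanSpace ℝ (Fin a) → EuclideanSpace ℝ (Fin b)} {u : EuclideanSpace ℝ (Fin a)}
    (h : (jacobianMatrix F u).rank = b) : Function.Surjective (fderiv ℝ F u) := by
  rw [jacobianMatrix_eq_stdMatrix, rank_stdMatrix] at h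
  exact LinearMap.range_eq_top.1 (Submodule.eq_top_of_finrank_eq (by simpa using h))

theorem lemma2 {m n q : ℕ} {Ω : Type*} [MeasurableSpace Ω]
    (P : Measure Ω) [IsProbabilityMeasure P]
    (Υ : Set (EuclideanSpace ℝ (Fin m))) (Θ : Set (EuclideanSpace ℝ (Fin q)))
    (𝒴 : Set (EuclideanSpace ℝ (Fin n)))
    (hΥ : IsOpen Υ) (hΘ : IsOpen Θ) (h𝒴 : MeasurableSet 𝒴)
    (G : EuclideanSpace ℝ (Fin m) → EuclideanSpace ℝ (Fin q) → EuclideanSpace ℝ (Fin n))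
    (hG𝒴 : ∀ u ∈ Υ, ∀ θ ∈ Θ, G u θ ∈ 𝒴)
    (hG : ContDiffOn ℝ 3 (Function.uncurry G) (Υ ×ˢ Θ))
    (hrank : ∀ u ∈ Υ, ∀ θ ∈ Θ, (jacobianU G u θ).rank = n)
    (U : Ω → EuclideanSpace ℝ (Fin m)) (ρ : EuclideanSpace ℝ (Fin m) → ℝ)
    (hρ_meas : Measurable ρ) (hρ_nonneg : ∀ u ∈ Υ, 0 ≤ ρ u)
    (hU : HasPDF U P (volume.restrict Υ))
    (hUρ : pdf U P (volume.restrict Υ) =ᵐ[volume.restrict Υ] fun u => ENNReal.ofReal (ρ u)) :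
    ∀ θ ∈ Θ,
      HasPDF (fun ω => G (U ω) θ) P (volume.restrict 𝒴) ∧
      ∀ᵐ y ∂(volume.restrict 𝒴),
        IntegrableOn
          (fun u => ρ u / Real.sqrt (jacobianU G u θ * (jacobianU G u θ)ᵀ).det)
          (thetaSection Υ G θ y) (riemannianMeasure (m - n) (thetaSection Υ G θ y)) ∧
        likelihood P U 𝒴 G y θ = ENNReal.ofReal
          (∫ u in thetaSection Υ G θ y,
            ρ u / Real.sqrt (jacobianU G u θ * (jacobianU G u θ)ᵀ).det
            ∂(riemannianMeasure (m - n) (thetaSection Υ G θ y))) := by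
  intro θ hθ
  have hmapU : Measure.map U P =
      (volume.restrict Υ).withDensity fun u => ENNReal.ofReal (ρ u) := by
    rw [map_eq_withDensity_pdf U P (volume.restrict Υ), withDensity_congr_ae hUρ]
  have hUm : AEMeasurable U P := HasPDF.aemeasurable U P (volume.restrict Υ)
  -- Were `Υ` empty, the law of `U` would be zero, contradicting total mass one.
  have hne : Υ.Nonempty := by
    rw [Set.nonempty_iff_ne_empty]
    rintro rfl
    rw [Measure.restrict_empty, withDensity_zero_left, Measure.map_eq_zero_iff hUm] at hmapU
    exact IsProbabilityMeasure.ne_zero P hmapU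
  -- The rank `n` is at most the number `m` of columns, so the natural subtraction `m - n` is not
  -- truncated.
  obtain ⟨k, rfl⟩ : ∃ k, m = n + k := by
    obtain ⟨u, hu⟩ := hne
    refine Nat.exists_eq_add_of_le ?_
    rw [← hrank u hu θ hθ]
    exact (Matrix.rank_le_width _)
  rw [Nat.add_sub_cancel_left]
  set F : EuclideanSpace ℝ (Fin (n + k)) → EuclideanSpace ℝ (Fin n) := fun u => G u θ with hFdef
  have hF : ContDiffOn ℝ 1 F Υ := by
    refine (hG.of_le (by norm_num)).comp (f := fun u => (u, θ)) ?_ fun u hu => ⟨hu, hθ⟩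
    exact contDiffOn_id.prodMk contDiffOn_const
  have hsurj : ∀ u ∈ Υ, Function.Surjective (fderiv ℝ F u) := fun u hu =>
    surjective_fderiv_of_rank_jacobianMatrix (hrank u hu θ hθ)
  have hρm : Measurable fun u => ENNReal.ofReal (ρ u) := hρ_meas.ennreal_ofReal
  have hmapF := map_withDensity_eq_withDensity_fibre hΥ hne hF hsurj hρm h𝒴
    fun u hu => hG𝒴 u hu θ hθ
  have hhm := (setLIntegral_eq_lintegral_fibre hΥ hne hF hsurj hρm).1
  have hFm : AEMeasurable F (Measure.map U P) := by
    rw [hmapU]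
    exact (hF.continuousOn.aemeasurable hΥ.measurableSet).mono_ac
      (withDensity_absolutelyContinuous _ _)
  rw [← hmapU, AEMeasurable.map_map_of_aemeasurable hFm hUm] at hmapF
  have hpdf : HasPDF (fun ω => G (U ω) θ) P (volume.restrict 𝒴) :=
    hasPDF_of_map_eq_withDensity (hFm.comp_aemeasurable hUm) _ hhm.aemeasurable hmapF
  refine ⟨hpdf, ?_⟩
  -- Almost everywhere the density equals the fibre integral and is finite, being that of a
  -- probability measure. Finiteness yields integrability on the fibre and hence equality with the
  -- real integral.
  filter_upwards [(pdf.eq_of_map_eq_withDensity (X := fun ω => G (U ω) θ) _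
      hhm.aemeasurable).1 hmapF,
    pdf.ae_lt_top (ℙ := P) (μ := volume.restrict 𝒴) (X := fun ω => G (U ω) θ)] with y hy hfin
  change IntegrableOn (fun u => ρ u / Real.sqrt (jacobianMatrix F u * (jacobianMatrix F u)ᵀ).det)
      {u | u ∈ Υ ∧ F u = y} (riemannianMeasure k {u | u ∈ Υ ∧ F u = y}) ∧
    pdf (fun ω => G (U ω) θ) P (volume.restrict 𝒴) y = ENNReal.ofReal
      (∫ u in {u | u ∈ Υ ∧ F u = y},
        ρ u / Real.sqrt (jacobianMatrix F u * (jacobianMatrix F u)ᵀ).det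
        ∂(riemannianMeasure k {u | u ∈ Υ ∧ F u = y}))
  have hae : ∀ᵐ u ∂(riemannianMeasure k {u | u ∈ Υ ∧ F u = y}), u ∈ Υ ∧ F u = y :=
    riemannianMeasure_fibre_compl hΥ hne hF hsurj y
  have hres : (riemannianMeasure k {u | u ∈ Υ ∧ F u = y}).restrict {u | u ∈ Υ ∧ F u = y} =
      riemannianMeasure k {u | u ∈ Υ ∧ F u = y} := Measure.restrict_eq_self_of_ae_mem hae
  rw [IntegrableOn, hres]
  have hnn : 0 ≤ᵐ[riemannianMeasure k {u | u ∈ Υ ∧ F u = y}]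
      fun u => ρ u / Real.sqrt (jacobianMatrix F u * (jacobianMatrix F u)ᵀ).det := by
    filter_upwards [hae] with u hu using div_nonneg (hρ_nonneg u hu.1) (Real.sqrt_nonneg _)
  have hlin : ∫⁻ u, ENNReal.ofReal (ρ u / Real.sqrt (jacobianMatrix F u *
      (jacobianMatrix F u)ᵀ).det) ∂(riemannianMeasure k {u | u ∈ Υ ∧ F u = y}) =
      pdf (fun ω => G (U ω) θ) P (volume.restrict 𝒴) y := by
    refine Eq.trans (lintegral_congr_ae ?_) hy.symm
    filter_upwards [hae] with u hu
    exact ENNReal.ofReal_div_of_pos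
      (Real.sqrt_pos.2 (det_jacobianMatrix_mul_transpose_pos (hsurj u hu.1)))
  have hint : Integrable (fun u => ρ u / Real.sqrt (jacobianMatrix F u *
      (jacobianMatrix F u)ᵀ).det) (riemannianMeasure k {u | u ∈ Υ ∧ F u = y}) := by
    refine ⟨(hρ_meas.div
      (measurable_det_jacobianMatrix_mul_transpose F).sqrt).aestronglyMeasurable, ?_⟩
    rw [hasFiniteIntegral_iff_ofReal hnn, hlin]
    exact hfin
  exact ⟨hint, by rw [ofReal_integral_eq_lintegral_ofReal hint hnn, hlin]⟩
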